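/- Let $N\ge 0$ be an integer, let $\mathcal E_1\le\dots\le\mathcal E_N$ be real numbers with $\sum_i\mathcal E_i=0$, let $A=-i\,\mathrm{diag}(\mathcal E_1,\dots,\mathcal E_N)$, and let $B=(b_{ij})\in\mathfrak{su}(N)$, i.e. $B$ is a complex $N\times N$ matrix that is skew-Hermitian and traceless. Consider the control system $$\dot X(t)=\bigl(A+u(t)B\bigr)X(t),\qquad X(t)\in SU(N),\qquad X(0)=I,$$ with real-valued piecewise constant controls $u$ (a trajectory on $[0,T]$ is a continuous curve in $SU(N)$ that satisfies the equation except at finitely many times). The system is called controllable if every element of $SU(N)$ equals $X(T)$ for some $T\ge 0$, some control $u$ on $[0,T]$ and a corresponding trajectory $X$. For $i\ne j$ let $\alpha_{ij}$ be the root of $\mathfrak{sl}_N(\mathbb C)$ given by $\mathrm{diag}(\lambda_1,\dots,\lambda_N)\mapsto\lambda_i-\lambda_j$ (on traceless diagonal matrices). Let $\Delta=\{\alpha_{ij}: i\ne j\}$, let $\Delta^+=\{\alpha_{ij}: i<j\}$ be the set of positive roots, and let $\Phi$ be the set of fundamental roots, i.e. of the positive roots that are not the sum of two positive roots; thus $\Phi=\{\alpha_{12},\alpha_{23},\dots,\alpha_{N-1,N}\}$.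 Write $A=iH$, so that $H=-\mathrm{diag}(\mathcal E_1,\dots,\mathcal E_N)$ and $\alpha_{ij}(H)=\mathcal E_j-\mathcal E_i$. A positive root $\alpha_{ij}$ is touched by $B$ if $b_{ij}\neq 0$. A positive root $\alpha$ is regular for $A$ if $\alpha(H)\ne0$ and $\beta(H)\neq\alpha(H)$ for every root $\beta\in\Delta$ with $\beta\ne\alpha$. Let $\Theta_A^+$ be the set of positive roots that are touched by $B$ and regular for $A$. If $\Phi\subseteq\Theta_A^+$, i.e. every fundamental root is touched by $B$ and regular for $A$, then the system is controllable. -/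

import Mathlib

namespace QControl

/-- Real traceless diagonal `N × N` matrices `diag(x₁, …, x_N)`, recorded by their diagonals: the
real form on which the roots of `A_{N-1}` take real values. -/
def realCartan (N : ℕ) : Submodule ℝ (Fin N → ℝ) :=
  LinearMap.ker (∑ i : Fin N, (LinearMap.proj i : (Fin N → ℝ) →ₗ[ℝ] ℝ))

/-- The functional `α_{ij} : diag(x) ↦ x_i - x_j`. -/
def root {N : ℕ} (i j : Fin N) : Module.Dual ℝ (realCartan N) :=
  ((LinearMap.proj i : (Fin N → ℝ) →ₗ[ℝ] ℝ) - LinearMap.proj j).comp (realCartan N).subtype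

/-- The set `Δ` of nonzero roots. -/
def roots (N : ℕ) : Set (Module.Dual ℝ (realCartan N)) :=
  {α | ∃ i j : Fin N, i ≠ j ∧ α = root i j}

/-- The set `Δ⁺` of positive roots. -/
def posRoots (N : ℕ) : Set (Module.Dual ℝ (realCartan N)) :=
  {α | ∃ i j : Fin N, i < j ∧ α = root i j}

/-- The set `Φ` of fundamental roots: the positive roots that are not the sum of two positive
roots (these are the roots `α_{i,i+1}`). -/
def fundamentalRoots (N : ℕ) : Set (Module.Dual ℝ (realCartan N)) :=
  {α ∈ posRoots N | ∀ β ∈ posRoots N, ∀ γ ∈ posRoots N, α ≠ β + γ}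

/-- The Lie algebra `𝔰𝔲(N)` (as a set): skew-Hermitian traceless matrices. -/
def su (N : ℕ) : Set (Matrix (Fin N) (Fin N) ℂ) :=
  {M | M.conjTranspose = -M ∧ M.trace = 0}

/-- The drift `A = -i diag(E₁, …, E_N)` with energy levels `E`. -/
noncomputable def drift {N : ℕ} (E : realCartan N) : Matrix (Fin N) (Fin N) ℂ :=
  Matrix.diagonal fun k => -Complex.I * ((E : Fin N → ℝ) k : ℂ)

/-- The set `Γ⁺` of positive roots touched by `B`. For skew-Hermitian `B` and `i < j`, the
coefficients of `B` along `X_{ij} = E_{ij} - E_{ji}` and `Y_{ij} = i (E_{ij} + E_{ji})` are the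
real and imaginary parts of the entry `B i j`. -/
def touchedRoots {N : ℕ} (B : Matrix (Fin N) (Fin N) ℂ) : Set (Module.Dual ℝ (realCartan N)) :=
  {α | ∃ i j : Fin N, i < j ∧ B i j ≠ 0 ∧ α = root i j}

/-- The set `Π⁺_A` of positive roots that are regular for `A = drift E`: their value at `A` is
nonzero and different from the value of every other root. Roots are evaluated at the matrix
`H = -diag(E)` for which `A = i H`, so that `α_{ij}` has the value `E_j - E_i`. -/
def regularPosRoots {N : ℕ} (E : realCartan N) : Set (Module.Dual ℝ (realCartan N)) :=
  {α ∈ posRoots N | α (-E) ≠ 0 ∧ ∀ β ∈ roots N, β ≠ α → β (-E) ≠ α (-E)}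

/-- `Θ⁺_A = Γ⁺ ∩ Π⁺_A`. -/
def touchedRegularRoots {N : ℕ} (E : realCartan N) (B : Matrix (Fin N) (Fin N) ℂ) :
    Set (Module.Dual ℝ (realCartan N)) :=
  touchedRoots B ∩ regularPosRoots E

/-- `u` is piecewise constant on `[0, T]`: there are finitely many points such that `u` is constant
on every subinterval that contains none of them. -/
def IsPiecewiseConstant (u : ℝ → ℝ) (T : ℝ) : Prop :=
  ∃ F : Finset ℝ, ∀ s t : ℝ, 0 ≤ s → s ≤ t → t ≤ T → (∀ r ∈ F, r ∉ Set.Icc s t) → u s = u t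

/-- `X` is an integral curve on `[0, T]`, starting at the identity, of the control system
`X' = (A + u(t) B) X` on `SU(N)`: it is continuous and satisfies the equation (entry by entry)
except at finitely many times. -/
def IsTrajectory {N : ℕ} (A B : Matrix (Fin N) (Fin N) ℂ) (u : ℝ → ℝ) (T : ℝ)
    (X : ℝ → Matrix.specialUnitaryGroup (Fin N) ℂ) : Prop :=
  X 0 = 1 ∧ ContinuousOn X (Set.Icc 0 T) ∧
    ∃ F : Finset ℝ, ∀ t ∈ Set.Ioo 0 T, t ∉ F → ∀ i j : Fin N,
      HasDerivAt (fun s => (X s : Matrix (Fin N) (Fin N) ℂ) i j)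
        (((A + (u t : ℂ) • B) * (X t : Matrix (Fin N) (Fin N) ℂ)) i j) t

/-- The set of all points of `SU(N)` reachable from the identity in some time `T ≥ 0`. -/
def reachableSet {N : ℕ} (A B : Matrix (Fin N) (Fin N) ℂ) :
    Set (Matrix.specialUnitaryGroup (Fin N) ℂ) :=
  {Z | ∃ T : ℝ, 0 ≤ T ∧ ∃ u : ℝ → ℝ, IsPiecewiseConstant u T ∧
    ∃ X : ℝ → Matrix.specialUnitaryGroup (Fin N) ℂ, IsTrajectory A B u T X ∧ X T = Z}

/-- (Global) controllability: the reachable set is the whole group. -/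
def Controllable {N : ℕ} (A B : Matrix (Fin N) (Fin N) ℂ) : Prop :=
  reachableSet A B = Set.univ

end QControl

namespace QControl

open Matrix

variable {N : ℕ}

/-! ### Roots -/

/-! The theorem combines a Lie algebra computation with the rank condition for right-invariant
systems on a compact connected group.

Algebra: bracketing with $A$ multiplies the entry $(j,k)$ by $i(\mathcal E_k-\mathcal E_j)$. Since
the gap of a fundamental root is nonzero and shared with no other root, a polynomial in
$(\mathrm{ad}\,A)^2$ cuts $B$ down to its entries at $(i,i+1)$ and $(i+1,i)$
(`twoLevel_entry_mem_of_gap_unique`). A further bracket with $A$ gives all complex multiples, and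
brackets of neighbours give all of $\mathfrak{su}(N)$ (`su_subset_of_fundamentalRoots_subset`).

Geometry: products of forward flows form a monoid of reachable points. A family in it with tangent
space of maximal dimension cannot be enlarged by inserting another flow, so that space contains a
conjugate of every direction in `conjSpan`, hence $\mathfrak{su}(N)$ (`exists_hasTangent_su`). The
monoid therefore has an interior point in $SU(N)$ (`HasTangent.eventually_mem`), and in a compact
connected group such a submonoid is everything (`submonoid_eq_top_of_mem_nhds`). -/

theorem root_apply (i j : Fin N) (x : realCartan N) :
    root i j x = (x : Fin N → ℝ) i - (x : Fin N → ℝ) j := rfl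

theorem mem_realCartan {x : Fin N → ℝ} : x ∈ realCartan N ↔ ∑ i, x i = 0 := by
  simp [realCartan, LinearMap.mem_ker]

/-- Test on $e_i-e_j$: its coordinates lie in $\{-1,0,1\}$, so only `root i j` takes the value 2
there. -/
theorem root_eq_root_iff {i j k l : Fin N} (hij : i ≠ j) :
    root i j = root k l ↔ i = k ∧ j = l := by
  constructor
  · intro h
    have hx : (Pi.single i 1 - Pi.single j 1 : Fin N → ℝ) ∈ realCartan N := by
      simp [mem_realCartan]
    have h1 := LinearMap.congr_fun h ⟨_, hx⟩
    simp only [root_apply, Pi.sub_apply, Pi.single_apply] at h1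
    by_cases hik : i = k
    · by_cases hjl : j = l
      · exact ⟨hik, hjl⟩
      · subst hik
        simp [hij, Ne.symm hij] at h1
        split_ifs at h1 <;> simp_all
    · simp [hij, Ne.symm hij] at h1
      split_ifs at h1 <;> simp_all <;> norm_num at h1
  · rintro ⟨rfl, rfl⟩
    rfl

theorem root_succ_mem_fundamentalRoots {i j : Fin N} (h : (i : ℕ) + 1 = j) :
    root i j ∈ fundamentalRoots N := by
  have hij : i < j := by rw [Fin.lt_def]; omega
  refine ⟨⟨i, j, hij, rfl⟩, ?_⟩
  rintro _ ⟨a, b, hab, rfl⟩ _ ⟨c, d, hcd, rfl⟩ heq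
  -- `m` is the mean index, so the vector `m - k` is traceless. On it $\alpha_{ab}$ takes the value
  -- $b-a$, the height: a sum of two positive roots has height at least 2, while `root i j` has
  -- height 1.
  let m : ℝ := (∑ k : Fin N, (k : ℝ)) / N
  have hx : (fun k : Fin N => m - (k : ℝ)) ∈ realCartan N := by
    have : (N : ℝ) ≠ 0 := by
      have := i.pos
      positivity
    rw [mem_realCartan]
    simp [m, Finset.sum_sub_distrib]
    field_simp
    simp
  have h1 := LinearMap.congr_fun heq ⟨_, hx⟩
  simp only [LinearMap.add_apply, root_apply] at h1
  have h2 : (i : ℝ) + 1 = (j : ℝ) := by exact_mod_cast h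
  have h3 : (a : ℝ) + 1 ≤ (b : ℝ) := by exact_mod_cast hab
  have h4 : (c : ℝ) + 1 ≤ (d : ℝ) := by exact_mod_cast hcd
  linarith

/-- What the hypothesis on the fundamental roots says in terms of matrix entries. -/
theorem entry_ne_zero_and_gap_unique {E : realCartan N} {B : Matrix (Fin N) (Fin N) ℂ}
    (hΦ : fundamentalRoots N ⊆ touchedRegularRoots E B) {i j : Fin N} (h : (i : ℕ) + 1 = j) :
    B i j ≠ 0 ∧ (E : Fin N → ℝ) j ≠ (E : Fin N → ℝ) i ∧
      ∀ k l : Fin N, k ≠ l → (k ≠ i ∨ l ≠ j) →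
        (E : Fin N → ℝ) l - (E : Fin N → ℝ) k ≠ (E : Fin N → ℝ) j - (E : Fin N → ℝ) i := by
  have hij : i ≠ j := by rintro rfl; omega
  obtain ⟨⟨a, b, -, hB, hab⟩, -, h0, hreg⟩ := hΦ (root_succ_mem_fundamentalRoots h)
  obtain ⟨rfl, rfl⟩ := (root_eq_root_iff hij).1 hab
  refine ⟨hB, ?_, ?_⟩
  · intro h1
    apply h0
    simp [root_apply, h1]
  · intro k l hkl hne h1
    refine hreg (root k l) ⟨k, l, hkl, rfl⟩ ?_ ?_
    · intro h2
      obtain ⟨rfl, rfl⟩ := (root_eq_root_iff hkl).1 h2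
      simp at hne
    · simp only [root_apply, Submodule.coe_neg, Pi.neg_apply]
      linarith

/-! ### The Lie algebra generated by the drift and the control -/

attribute [local instance] LieRing.ofAssociativeRing

theorem drift_lie_apply (E : realCartan N) (X : Matrix (Fin N) (Fin N) ℂ) (j k : Fin N) :
    ⁅drift E, X⁆ j k =
      Complex.I * (((E : Fin N → ℝ) k - (E : Fin N → ℝ) j : ℝ) : ℂ) * X j k := by
  rw [Ring.lie_def, Matrix.sub_apply, drift, Matrix.diagonal_mul, Matrix.mul_diagonal]
  push_cast
  ring

/-- The element `z E_{jk} - conj z E_{kj}` of `𝔰𝔲(N)`. -/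
def twoLevel (j k : Fin N) (z : ℂ) : Matrix (Fin N) (Fin N) ℂ :=
  single j k z - single k j (star z)

theorem twoLevel_swap (j k : Fin N) (z : ℂ) : twoLevel k j z = - twoLevel j k (star z) := by
  simp [twoLevel]

theorem twoLevel_add (j k : Fin N) (z w : ℂ) :
    twoLevel j k (z + w) = twoLevel j k z + twoLevel j k w := by
  simp only [twoLevel, star_add, Matrix.single_add]
  abel

theorem twoLevel_smul (j k : Fin N) (r : ℝ) (z : ℂ) :
    twoLevel j k (r * z) = r • twoLevel j k z := by
  simp [twoLevel, smul_sub, Matrix.smul_single]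

theorem twoLevel_lie_twoLevel {j k l : Fin N} (hjk : j ≠ k) (hkl : k ≠ l) (hjl : j ≠ l)
    (z w : ℂ) : ⁅twoLevel j k z, twoLevel k l w⁆ = twoLevel j l (z * w) := by
  simp [Ring.lie_def, twoLevel, sub_mul, mul_sub, Matrix.single_mul_single_of_ne, hjk, hkl, hjl,
    hjk.symm, hkl.symm, hjl.symm, mul_comm]

theorem twoLevel_lie_twoLevel_same {j k : Fin N} (hjk : j ≠ k) :
    ⁅twoLevel j k 1, twoLevel j k Complex.I⁆ =
      (2 : ℝ) • (single j j Complex.I - single k k Complex.I) := by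
  simp only [Ring.lie_def, twoLevel, sub_mul, mul_sub, Matrix.single_mul_single_same,
    Matrix.single_mul_single_of_ne _ _ _ _ hjk, Matrix.single_mul_single_of_ne _ _ _ _ hjk.symm]
  have hneg : ∀ a : Fin N, single a a (-Complex.I) = -single a a Complex.I := fun a => by
    ext
    simp only [Matrix.single_apply, Matrix.neg_apply]
    split_ifs <;> simp
  simp [two_smul, hneg]
  abel

/-- Each factor is the operator $\mu+(\mathrm{ad}\,A)^2$. Squaring makes its eigenvalues real, so a
real Lie subalgebra suffices. -/
theorem prod_gap_mem {L : LieSubalgebra ℝ (Matrix (Fin N) (Fin N) ℂ)} {E : realCartan N}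
    {B : Matrix (Fin N) (Fin N) ℂ} (hA : drift E ∈ L) (hB : B ∈ L) (s : Finset ℝ) :
    Matrix.of (fun j k => ((∏ μ ∈ s, (μ - ((E : Fin N → ℝ) k - (E : Fin N → ℝ) j) ^ 2) : ℝ) : ℂ)
      * B j k) ∈ L := by
  induction s using Finset.induction_on with
  | empty => simpa using! hB
  | insert μ s hμ ih =>
    have h1 := L.add_mem (L.smul_mem μ ih) (L.lie_mem hA (L.lie_mem hA ih))
    convert! h1 using 1
    ext j k
    rw [Matrix.add_apply, drift_lie_apply, drift_lie_apply, Matrix.smul_apply, Matrix.of_apply,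
      Matrix.of_apply, Finset.prod_insert hμ]
    push_cast
    rw [Complex.real_smul]
    linear_combination (-((E : Fin N → ℝ) k - (E : Fin N → ℝ) j : ℂ) ^ 2 *
      (∏ μ ∈ s, (μ - ((E : Fin N → ℝ) k - (E : Fin N → ℝ) j : ℂ) ^ 2)) * B j k) * Complex.I_sq

theorem twoLevel_apply_left {i j : Fin N} (hij : i ≠ j) (z : ℂ) : twoLevel i j z i j = z := by
  simp [twoLevel, hij, hij.symm]

theorem twoLevel_apply_right {i j : Fin N} (hij : i ≠ j) (z : ℂ) :
    twoLevel i j z j i = -star z := by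
  simp [twoLevel, hij, hij.symm]

theorem twoLevel_apply_eq_zero {i j k l : Fin N} (h1 : ¬(k = i ∧ l = j)) (h2 : ¬(k = j ∧ l = i))
    (z : ℂ) : twoLevel i j z k l = 0 := by
  rw [twoLevel, Matrix.sub_apply, Matrix.single_apply, Matrix.single_apply,
    if_neg fun h => h1 ⟨h.1.symm, h.2.symm⟩, if_neg fun h => h2 ⟨h.1.symm, h.2.symm⟩, sub_zero]

theorem star_apply_of_mem_su {M : Matrix (Fin N) (Fin N) ℂ} (hM : M ∈ su N) (k l : Fin N) :
    star (M k l) = - M l k := by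
  simpa using congrFun (congrFun hM.1 l) k

/-- Take for the $\mu$'s all squared gaps except that of $(i,j)$; every entry with another squared
gap is killed. The square does not separate $(i,j)$ from $(j,i)$, and these two entries of a
skew-Hermitian `B` form exactly a `twoLevel` matrix. -/
theorem twoLevel_entry_mem_of_gap_unique {L : LieSubalgebra ℝ (Matrix (Fin N) (Fin N) ℂ)}
    {E : realCartan N} {B : Matrix (Fin N) (Fin N) ℂ} (hBsu : B ∈ su N)
    (hA : drift E ∈ L) (hB : B ∈ L) {i j : Fin N} (hij : i ≠ j)
    (hgap : (E : Fin N → ℝ) j ≠ (E : Fin N → ℝ) i)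
    (huniq : ∀ k l : Fin N, k ≠ l → (k ≠ i ∨ l ≠ j) →
        (E : Fin N → ℝ) l - (E : Fin N → ℝ) k ≠ (E : Fin N → ℝ) j - (E : Fin N → ℝ) i) :
    twoLevel i j (B i j) ∈ L := by
  let e : Fin N → ℝ := (E : Fin N → ℝ)
  let c : ℝ := (e j - e i) ^ 2
  let s : Finset ℝ :=
    (Finset.univ.image fun p : Fin N × Fin N => (e p.2 - e p.1) ^ 2).erase c
  let r : ℝ := ∏ μ ∈ s, (μ - c)
  have hr : r ≠ 0 := Finset.prod_ne_zero_iff.2 fun μ hμ =>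
    sub_ne_zero.2 (Finset.ne_of_mem_erase hμ)
  have key : r • twoLevel i j (B i j) ∈ L := by
    convert! prod_gap_mem hA hB s using 1
    ext k l
    rw [Matrix.of_apply, Matrix.smul_apply, Complex.real_smul]
    by_cases h1 : k = i ∧ l = j
    · obtain ⟨rfl, rfl⟩ := h1
      rw [twoLevel_apply_left hij]
    by_cases h2 : k = j ∧ l = i
    · obtain ⟨rfl, rfl⟩ := h2
      rw [twoLevel_apply_right hij, star_apply_of_mem_su hBsu, neg_neg]
      have hc : ((E : Fin N → ℝ) l - (E : Fin N → ℝ) k) ^ 2 = c := by simp only [c, e]; ring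
      rw [hc]
    · have hmem : (e l - e k) ^ 2 ∈ s := by
        refine Finset.mem_erase.2 ⟨?_, Finset.mem_image.2 ⟨(k, l), Finset.mem_univ _, rfl⟩⟩
        intro h3
        -- Diagonal entries have gap 0, excluded by `hgap`; off the diagonal the gap is plus or
        -- minus that of $(i,j)$, and the minus sign is handled by `huniq` for the transposed
        -- position.
        by_cases hkl : k = l
        · subst hkl
          simp only [sub_self, c] at h3
          exact hgap (sub_eq_zero.1 (pow_eq_zero_iff two_ne_zero |>.1 (h3.symm.trans (by simp))))
        rcases sq_eq_sq_iff_eq_or_eq_neg.1 h3 with h4 | h4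
        · exact huniq k l hkl (not_and_or.1 h1) h4
        · exact huniq l k (Ne.symm hkl) (not_and_or.1 fun h => h2 h.symm) (by linarith)
      have hz : ∏ μ ∈ s, (μ - ((E : Fin N → ℝ) l - (E : Fin N → ℝ) k) ^ 2) = 0 :=
        Finset.prod_eq_zero hmem (sub_self _)
      rw [hz, twoLevel_apply_eq_zero h1 h2]
      simp
  have := L.smul_mem r⁻¹ key
  rwa [smul_smul, inv_mul_cancel₀ hr, one_smul] at this

theorem drift_lie_twoLevel (E : realCartan N) {i j : Fin N} (hij : i ≠ j) (z : ℂ) :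
    ⁅drift E, twoLevel i j z⁆ =
      ((E : Fin N → ℝ) j - (E : Fin N → ℝ) i) • twoLevel i j (Complex.I * z) := by
  ext k l
  rw [Matrix.smul_apply, drift_lie_apply, Complex.real_smul]
  by_cases h1 : k = i ∧ l = j
  · obtain ⟨rfl, rfl⟩ := h1
    rw [twoLevel_apply_left hij, twoLevel_apply_left hij]
    ring
  by_cases h2 : k = j ∧ l = i
  · obtain ⟨rfl, rfl⟩ := h2
    rw [twoLevel_apply_right hij, twoLevel_apply_right hij]
    simp
    ring
  · rw [twoLevel_apply_eq_zero h1 h2, twoLevel_apply_eq_zero h1 h2]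
    simp

/-- Up to a nonzero real factor, bracketing with the drift replaces $b$ by $ib$, and $b, ib$ is a
real basis of $\mathbb C$. -/
theorem twoLevel_mem_of_entry_mem {L : LieSubalgebra ℝ (Matrix (Fin N) (Fin N) ℂ)}
    {E : realCartan N} (hA : drift E ∈ L) {i j : Fin N} (hij : i ≠ j)
    (hgap : (E : Fin N → ℝ) j ≠ (E : Fin N → ℝ) i) {b : ℂ} (hb : b ≠ 0)
    (h1 : twoLevel i j b ∈ L) (z : ℂ) : twoLevel i j z ∈ L := by
  have h2 : twoLevel i j (Complex.I * b) ∈ L := by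
    have := L.smul_mem ((E : Fin N → ℝ) j - (E : Fin N → ℝ) i)⁻¹ (L.lie_mem hA h1)
    rwa [drift_lie_twoLevel E hij, smul_smul, inv_mul_cancel₀ (sub_ne_zero.2 hgap), one_smul]
      at this
  have h3 : z = ((z / b).re : ℝ) * b + ((z / b).im : ℝ) * (Complex.I * b) := by
    have h4 := Complex.re_add_im (z / b)
    have h5 : z / b * b = z := div_mul_cancel₀ z hb
    linear_combination -h5 - b * h4
  rw [h3, twoLevel_add, twoLevel_smul, twoLevel_smul]
  exact L.add_mem (L.smul_mem _ h1) (L.smul_mem _ h2)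

theorem twoLevel_mem_of_succ {L : LieSubalgebra ℝ (Matrix (Fin N) (Fin N) ℂ)}
    (h : ∀ i j : Fin N, (i : ℕ) + 1 = j → ∀ z, twoLevel i j z ∈ L) {i j : Fin N} (hij : i ≠ j)
    (z : ℂ) : twoLevel i j z ∈ L := by
  -- Induction on the distance $j-i=n+1$, lengthening the transition by one neighbouring step with
  -- `twoLevel_lie_twoLevel`.
  have key : ∀ (n : ℕ) (i j : Fin N), (i : ℕ) + (n + 1) = j → ∀ z, twoLevel i j z ∈ L := by
    intro n
    induction n with
    | zero => exact h
    | succ n ih =>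
      intro i j hn z
      let k : Fin N := ⟨i + (n + 1), by omega⟩
      have hk : (k : ℕ) = i + (n + 1) := rfl
      have := L.lie_mem (ih i k rfl z) (h k j (by omega) 1)
      rwa [twoLevel_lie_twoLevel (by rw [Ne, Fin.ext_iff]; omega) (by rw [Ne, Fin.ext_iff]; omega)
        (by rw [Ne, Fin.ext_iff]; omega), mul_one] at this
  rcases lt_or_gt_of_ne hij with hlt | hlt
  · rw [Fin.lt_def] at hlt
    exact key (j - i - 1) i j (by omega) z
  · rw [Fin.lt_def] at hlt
    rw [twoLevel_swap]
    exact L.neg_mem (key (i - j - 1) j i (by omega) _)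

theorem su_subset_of_twoLevel_mem {L : LieSubalgebra ℝ (Matrix (Fin N) (Fin N) ℂ)}
    (h : ∀ i j : Fin N, i ≠ j → ∀ z, twoLevel i j z ∈ L) {M : Matrix (Fin N) (Fin N) ℂ}
    (hM : M ∈ su N) : M ∈ L := by
  have hskew := star_apply_of_mem_su hM
  have hdiff : ∀ j k : Fin N, single j j Complex.I - single k k Complex.I ∈ L := by
    intro j k
    by_cases hjk : j = k
    · subst hjk
      simp
    · have := L.smul_mem (2 : ℝ)⁻¹ (L.lie_mem (h j k hjk 1) (h j k hjk Complex.I))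
      rw [twoLevel_lie_twoLevel_same hjk, smul_smul] at this
      simpa using this
  have hdiag : Matrix.diagonal (fun j => M j j) ∈ L := by
    rcases isEmpty_or_nonempty (Fin N) with hN | ⟨⟨k⟩⟩
    · rw [Subsingleton.elim (Matrix.diagonal fun j => M j j) 0]
      exact L.zero_mem
    · have h1 : Matrix.diagonal (fun j => M j j) =
          ∑ j, (M j j).im • (single j j Complex.I - single k k Complex.I) := by
        have hre : ∀ j, M j j = (M j j).im * Complex.I := fun j => by
          have := congrArg Complex.re (hskew j j)
          apply Complex.ext <;> simp at this ⊢
          linarith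
        have htr : ∑ j, (M j j).im = 0 := by
          have := congrArg Complex.im hM.2
          simpa [Matrix.trace] using this
        simp only [smul_sub, Finset.sum_sub_distrib, ← Finset.sum_smul, htr, zero_smul, sub_zero]
        ext a b
        rw [Matrix.sum_apply, Matrix.diagonal_apply]
        simp only [Matrix.smul_apply, Matrix.single_apply]
        split_ifs with hab
        · subst hab
          conv_lhs => rw [hre a]
          simp
        · rw [Finset.sum_eq_zero]
          intro x _
          rw [if_neg (by rintro ⟨rfl, rfl⟩; exact hab rfl), smul_zero]
      rw [h1]
      exact L.toSubmodule.sum_mem fun j _ => L.smul_mem _ (hdiff j k)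
  -- The factor $1/2$ appears because the double sum meets each unordered pair twice.
  have hoff : M = Matrix.diagonal (fun j => M j j) +
      (2 : ℝ)⁻¹ • ∑ j, ∑ k, if j = k then 0 else twoLevel j k (M j k) := by
    ext a b
    rw [Matrix.add_apply, Matrix.smul_apply, Matrix.sum_apply, Matrix.diagonal_apply]
    simp only [Matrix.sum_apply]
    have hterm : ∀ j k : Fin N, (if j = k then (0 : Matrix (Fin N) (Fin N) ℂ)
        else twoLevel j k (M j k)) a b =
        (if j = a then if k = b then if a = b then 0 else M a b else 0 else 0) +
        (if k = a then if j = b then if a = b then 0 else M a b else 0 else 0) := by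
      intro j k
      by_cases hjk : j = k
      · subst hjk
        rw [if_pos rfl]
        split_ifs <;> simp_all
      · simp only [if_neg hjk, twoLevel, hskew, Matrix.sub_apply, Matrix.single_apply]
        split_ifs <;> simp_all
    simp only [hterm, Finset.sum_add_distrib]
    simp
    split_ifs with hab
    · simp [hab]
    · ring
  rw [hoff]
  refine L.add_mem hdiag (L.smul_mem _ (L.toSubmodule.sum_mem fun j _ =>
    L.toSubmodule.sum_mem fun k _ => ?_))
  split_ifs with hjk
  · exact L.zero_mem
  · exact h j k hjk _

theorem su_subset_of_fundamentalRoots_subset {L : LieSubalgebra ℝ (Matrix (Fin N) (Fin N) ℂ)}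
    {E : realCartan N} {B : Matrix (Fin N) (Fin N) ℂ} (hBsu : B ∈ su N)
    (hΦ : fundamentalRoots N ⊆ touchedRegularRoots E B)
    (hA : drift E ∈ L) (hB : B ∈ L) : su N ⊆ L := by
  intro M hM
  refine su_subset_of_twoLevel_mem (fun i j hij => twoLevel_mem_of_succ ?_ hij) hM
  intro i j hij z
  obtain ⟨h1, h2, h3⟩ := entry_ne_zero_and_gap_unique hΦ hij
  have hne : i ≠ j := by rintro rfl; omega
  exact twoLevel_mem_of_entry_mem hA hne h2 h1
    (twoLevel_entry_mem_of_gap_unique hBsu hA hB hne h2 h3) z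

end QControl
namespace QControl

open Matrix

/-! ### Topology of the special unitary group -/

section Topology

open scoped Matrix.Norms.L2Operator

variable {N : ℕ}

instance : IsTopologicalGroup (specialUnitaryGroup (Fin N) ℂ) where
  continuous_inv := by
    refine Continuous.subtype_mk (f := fun x : specialUnitaryGroup (Fin N) ℂ =>
      star (x : Matrix (Fin N) (Fin N) ℂ)) ?_ _
    exact continuous_star.comp continuous_subtype_val

theorem isClosed_specialUnitaryGroup :
    IsClosed (specialUnitaryGroup (Fin N) ℂ : Set (Matrix (Fin N) (Fin N) ℂ)) := by
  have h : (specialUnitaryGroup (Fin N) ℂ : Set (Matrix (Fin N) (Fin N) ℂ)) =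
      {A | A * star A = 1} ∩ {A | A.det = 1} := by
    ext A
    simp [mem_specialUnitaryGroup_iff, mem_unitaryGroup_iff]
  rw [h]
  exact (isClosed_eq (by fun_prop) continuous_const).inter
    (isClosed_eq (by fun_prop) continuous_const)

theorem isCompact_specialUnitaryGroup :
    IsCompact (specialUnitaryGroup (Fin N) ℂ : Set (Matrix (Fin N) (Fin N) ℂ)) := by
  have : ProperSpace (Matrix (Fin N) (Fin N) ℂ) := FiniteDimensional.proper ℂ _
  refine Metric.isCompact_of_isClosed_isBounded isClosed_specialUnitaryGroup ?_
  refine (Metric.isBounded_closedBall (x := (0 : Matrix (Fin N) (Fin N) ℂ)) (r := 1)).subset ?_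
  intro A hA
  rw [mem_closedBall_zero_iff]
  cases subsingleton_or_nontrivial (Matrix (Fin N) (Fin N) ℂ) with
  | inl h => simp [Subsingleton.elim A 0]
  | inr h => exact (CStarRing.norm_of_mem_unitary (specialUnitaryGroup_le_unitaryGroup hA)).le

instance : CompactSpace (specialUnitaryGroup (Fin N) ℂ) :=
  isCompact_iff_compactSpace.1 isCompact_specialUnitaryGroup

theorem smul_circle_mem_unitary (c : Circle) (u : unitary (Matrix (Fin N) (Fin N) ℂ)) :
    (c : ℂ) • (u : Matrix (Fin N) (Fin N) ℂ) ∈ unitary (Matrix (Fin N) (Fin N) ℂ) := by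
  refine Unitary.smul_mem_of_mem ?_ u.2
  rw [Unitary.mem_iff_self_mul_star]
  simpa using Complex.mul_conj (c : ℂ)

/-- The spectrum is finite, so some rotation $cu$ avoids the eigenvalue $-1$. Then $\|cu-1\|<2$ and
$cu$ is joined to 1; moving $c$ along the circle joins $cu$ to $u$. -/
theorem joined_one_unitary (u : unitary (Matrix (Fin N) (Fin N) ℂ)) : Joined 1 u := by
  obtain ⟨c, hc⟩ : ∃ c : Circle,
      -((c⁻¹ : Circle) : ℂ) ∉ spectrum ℂ (u : Matrix (Fin N) (Fin N) ℂ) := by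
    by_contra! h
    have hinj : Function.Injective fun c : Circle => -((c⁻¹ : Circle) : ℂ) := by
      intro a b hab
      exact Circle.ext (by simpa using hab)
    have hfin := (Matrix.finite_spectrum (u : Matrix (Fin N) (Fin N) ℂ)).subset
      (Set.range_subset_iff.2 h)
    have : Nontrivial Circle := ⟨1, -1, fun h => by
      have := congrArg (fun z : Circle => (z : ℂ)) h
      norm_num at this⟩
    have : Infinite Circle := PreconnectedSpace.infinite
    exact Set.infinite_range_of_injective hinj hfin
  let g : Circle → unitary (Matrix (Fin N) (Fin N) ℂ) := fun c =>
    ⟨(c : ℂ) • (u : Matrix (Fin N) (Fin N) ℂ), smul_circle_mem_unitary c u⟩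
  have hg : Continuous g := by
    refine Continuous.subtype_mk ?_ _
    fun_prop
  have h1 : Joined (g c) (g 1) := (PathConnectedSpace.joined c 1).map hg
  have hg1 : g 1 = u := by
    ext1
    simp [g]
  rw [hg1] at h1
  refine Joined.trans (Unitary.joined 1 (g c) ?_) h1
  rw [OneMemClass.coe_one, Unitary.norm_sub_one_lt_two_iff (g c).2]
  intro h2
  apply hc
  have h3 : (-1 : ℂ) = (c : ℂ) • (-((c⁻¹ : Circle) : ℂ)) := by
    rw [smul_eq_mul, mul_neg, ← Circle.coe_mul, mul_inv_cancel, Circle.coe_one]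
  rw [h3] at h2
  have := (spectrum.smul_mem_smul_iff (r := Units.mk0 (c : ℂ) (Circle.coe_ne_zero c))
    (a := (u : Matrix (Fin N) (Fin N) ℂ)) (s := -((c⁻¹ : Circle) : ℂ))).1 h2
  exact this

/-- Rescaling one column by the conjugate determinant retracts $U(n+1)$ onto $SU(n+1)$, which
transfers connectedness. -/
theorem diagonal_update_mul_mem {n : ℕ} (u : unitary (Matrix (Fin (n + 1)) (Fin (n + 1)) ℂ)) :
    (u : Matrix (Fin (n + 1)) (Fin (n + 1)) ℂ) * diagonal (Function.update (fun _ => (1 : ℂ)) 0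
      (star (u : Matrix (Fin (n + 1)) (Fin (n + 1)) ℂ).det)) ∈
      specialUnitaryGroup (Fin (n + 1)) ℂ := by
  have hdet : (u : Matrix (Fin (n + 1)) (Fin (n + 1)) ℂ).det *
      star (u : Matrix (Fin (n + 1)) (Fin (n + 1)) ℂ).det = 1 :=
    Unitary.mem_iff_self_mul_star.1 (det_of_mem_unitary u.2)
  rw [mem_specialUnitaryGroup_iff]
  constructor
  · refine mul_mem u.2 ?_
    rw [mem_unitaryGroup_iff, star_eq_conjTranspose, diagonal_conjTranspose, diagonal_mul_diagonal,
      ← diagonal_one]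
    congr 1
    ext i
    by_cases hi : i = 0
    · subst hi
      simpa [mul_comm] using hdet
    · simp [Function.update_of_ne hi]
  · rw [det_mul, det_diagonal, Finset.prod_update_of_mem (Finset.mem_univ _)]
    simpa using hdet

instance : ConnectedSpace (specialUnitaryGroup (Fin N) ℂ) := by
  rcases N with _ | n
  · have : Subsingleton (specialUnitaryGroup (Fin 0) ℂ) :=
      ⟨fun a b => Subtype.ext (Subsingleton.elim _ _)⟩
    exact { toNonempty := ⟨1⟩, isPreconnected_univ := Set.subsingleton_univ.isPreconnected }
  · have : PathConnectedSpace (unitary (Matrix (Fin (n + 1)) (Fin (n + 1)) ℂ)) :=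
      ⟨⟨1⟩, fun x y => (joined_one_unitary x).symm.trans (joined_one_unitary y)⟩
    let φ : unitary (Matrix (Fin (n + 1)) (Fin (n + 1)) ℂ) →
        specialUnitaryGroup (Fin (n + 1)) ℂ := fun u => ⟨_, diagonal_update_mul_mem u⟩
    have hφ : Continuous φ := by
      refine Continuous.subtype_mk (continuous_subtype_val.mul ?_) _
      refine Continuous.matrix_diagonal (continuous_const.update 0 ?_)
      exact continuous_star.comp continuous_subtype_val.matrix_det
    have hsurj : Function.Surjective φ := by
      intro g
      refine ⟨⟨g, specialUnitaryGroup_le_unitaryGroup g.2⟩, Subtype.ext ?_⟩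
      have hd : (g : Matrix (Fin (n + 1)) (Fin (n + 1)) ℂ).det = 1 :=
        (mem_specialUnitaryGroup_iff.1 g.2).2
      simp [φ, hd]
    exact hsurj.connectedSpace hφ

theorem exp_mem_specialUnitaryGroup {Z : Matrix (Fin N) (Fin N) ℂ} (hZ : Z ∈ su N) :
    NormedSpace.exp Z ∈ specialUnitaryGroup (Fin N) ℂ := by
  rw [mem_specialUnitaryGroup_iff]
  constructor
  · let : NormedAlgebra ℚ (Matrix (Fin N) (Fin N) ℂ) := .restrictScalars ℚ ℂ _
    exact NormedSpace.exp_mem_unitary_of_mem_skewAdjoint (skewAdjoint.mem_iff.2 hZ.1)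
  -- The determinant of $e^Z$ is $e^{\operatorname{tr} Z}=1$, obtained by diagonalising the
  -- Hermitian matrix $iZ$.
  · have hH : (Complex.I • Z).IsHermitian := by
      rw [IsHermitian, conjTranspose_smul, hZ.1]
      simp
    set U := (hH.eigenvectorUnitary : Matrix (Fin N) (Fin N) ℂ) with hUdef
    have hUU : U * star U = 1 := Unitary.mul_star_self_of_mem hH.eigenvectorUnitary.2
    have hinv : U⁻¹ = star U := Matrix.inv_eq_right_inv hUU
    have hunit : IsUnit U := ⟨⟨U, star U, hUU,
      Unitary.star_mul_self_of_mem hH.eigenvectorUnitary.2⟩, rfl⟩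
    have hZ' : Z = U * diagonal (fun i => -Complex.I * (hH.eigenvalues i : ℂ)) * U⁻¹ := by
      have h1 := hH.spectral_theorem
      rw [Unitary.conjStarAlgAut_apply] at h1
      have h2 : diagonal (fun i => -Complex.I * (hH.eigenvalues i : ℂ)) =
          -Complex.I • diagonal (RCLike.ofReal ∘ hH.eigenvalues : Fin N → ℂ) := by
        rw [← diagonal_smul]
        rfl
      rw [hinv, h2, Matrix.mul_smul, Matrix.smul_mul]
      rw [← hUdef] at h1
      rw [← h1, smul_smul]
      simp
    have htr : ∑ i, -Complex.I * (hH.eigenvalues i : ℂ) = 0 := by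
      have h1 := hZ.2
      rw [hZ', trace_mul_comm, ← mul_assoc, Matrix.nonsing_inv_mul _
        ((Matrix.isUnit_iff_isUnit_det _).1 hunit), one_mul, trace_diagonal] at h1
      exact h1
    rw [hZ', exp_conj _ _ hunit, det_conj hunit, exp_diagonal, det_diagonal]
    simp only [Pi.coe_exp, ← Complex.exp_eq_exp_ℂ]
    rw [← Complex.exp_sum, htr, Complex.exp_zero]

end Topology

end QControl
namespace QControl

open Matrix

/-! ### Reachability -/

section Reachability

open scoped Matrix.Norms.L2Operator

variable {N : ℕ}

theorem control_mem_su {A B : Matrix (Fin N) (Fin N) ℂ} (hA : A ∈ su N) (hB : B ∈ su N) (c : ℝ) :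
    A + (c : ℂ) • B ∈ su N := by
  refine ⟨?_, ?_⟩
  · rw [conjTranspose_add, conjTranspose_smul, hA.1, hB.1]
    simp [add_comm]
  · rw [trace_add, trace_smul, hA.2, hB.2]
    simp

theorem real_smul_mem_su {Z : Matrix (Fin N) (Fin N) ℂ} (hZ : Z ∈ su N) (t : ℝ) :
    t • Z ∈ su N := by
  refine ⟨?_, ?_⟩
  · rw [conjTranspose_smul, hZ.1]
    simp
  · rw [trace_smul, hZ.2, smul_zero]

/-- The monoid of products of flows of the control system. -/
def flowMonoid (A B : Matrix (Fin N) (Fin N) ℂ) : Submonoid (Matrix (Fin N) (Fin N) ℂ) :=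
  Submonoid.closure {X | ∃ t : ℝ, 0 ≤ t ∧ ∃ c : ℝ, X = NormedSpace.exp (t • (A + (c : ℂ) • B))}

theorem exp_mem_flowMonoid (A B : Matrix (Fin N) (Fin N) ℂ) {t : ℝ} (ht : 0 ≤ t) (c : ℝ) :
    NormedSpace.exp (t • (A + (c : ℂ) • B)) ∈ flowMonoid A B :=
  Submonoid.subset_closure ⟨t, ht, c, rfl⟩

theorem flowMonoid_le {A B : Matrix (Fin N) (Fin N) ℂ} (hA : A ∈ su N) (hB : B ∈ su N) :
    flowMonoid A B ≤ specialUnitaryGroup (Fin N) ℂ := by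
  refine Submonoid.closure_le.2 ?_
  rintro _ ⟨t, -, c, rfl⟩
  exact exp_mem_specialUnitaryGroup (real_smul_mem_su (control_mem_su hA hB c) t)

theorem one_mem_reachableSet (A B : Matrix (Fin N) (Fin N) ℂ) : 1 ∈ reachableSet A B := by
  refine ⟨0, le_rfl, fun _ => 0, ⟨∅, fun _ _ _ _ _ _ => rfl⟩, fun _ => 1,
    ⟨rfl, continuousOn_const, ∅, fun t ht => ?_⟩, rfl⟩
  exact absurd (ht.1.trans ht.2) (lt_irrefl _)

theorem hasDerivAt_entry {f : ℝ → Matrix (Fin N) (Fin N) ℂ} {f' : Matrix (Fin N) (Fin N) ℂ} {t : ℝ}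
    (h : HasDerivAt f f' t) (i j : Fin N) : HasDerivAt (fun s => f s i j) (f' i j) t :=
  ((Matrix.entryLinearMap ℝ ℂ i j).toContinuousLinearMap.hasFDerivAt
    (x := f t)).comp_hasDerivAt t h

/-- Run the old control up to time `T`, then the constant `c` for time `τ`. The equation is $X'=ZX$,
so later flows multiply on the left. The switching time `T` joins both exceptional sets. -/
theorem flow_mul_mem_reachableSet {A B : Matrix (Fin N) (Fin N) ℂ} (hA : A ∈ su N) (hB : B ∈ su N)
    {Y : specialUnitaryGroup (Fin N) ℂ} (hY : Y ∈ reachableSet A B) {τ : ℝ} (hτ : 0 ≤ τ) (c : ℝ)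
    {W : specialUnitaryGroup (Fin N) ℂ}
    (hW : (W : Matrix (Fin N) (Fin N) ℂ) = NormedSpace.exp (τ • (A + (c : ℂ) • B))) :
    W * Y ∈ reachableSet A B := by
  obtain ⟨T, hT, u, ⟨Fu, hFu⟩, X, ⟨hX0, hXc, F, hF⟩, rfl⟩ := hY
  set Z := A + (c : ℂ) • B with hZdef
  have hZ : Z ∈ su N := control_mem_su hA hB c
  let φ : ℝ → specialUnitaryGroup (Fin N) ℂ := fun t =>
    ⟨NormedSpace.exp (t • Z), exp_mem_specialUnitaryGroup (real_smul_mem_su hZ t)⟩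
  have hφc : Continuous φ := by
    refine Continuous.subtype_mk ?_ _
    exact continuous_iff_continuousAt.2 fun t =>
      (hasDerivAt_exp_smul_const (𝕂 := ℝ) Z t).continuousAt
  have hφ0 : φ 0 = 1 := Subtype.ext (by simp [φ])
  refine ⟨T + τ, by positivity, fun s => if s ≤ T then u s else c, ?_,
    fun s => if s ≤ T then X s else φ (s - T) * X T, ⟨?_, ?_, insert T F, ?_⟩, ?_⟩
  · refine ⟨insert T Fu, fun s t hs hst ht hr => ?_⟩
    have hTn := hr T (Finset.mem_insert_self _ _)
    by_cases htT : t ≤ T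
    · simp only [if_pos htT, if_pos (hst.trans htT)]
      exact hFu s t hs hst htT fun r hrF => hr r (Finset.mem_insert_of_mem hrF)
    · have hsT : ¬ s ≤ T := fun h => hTn ⟨h, (not_le.1 htT).le⟩
      simp only [if_neg htT, if_neg hsT]
  · simp [hT, hX0]
  · rw [← Set.Icc_union_Icc_eq_Icc hT (le_add_of_nonneg_right hτ)]
    refine ContinuousOn.union_of_isClosed ?_ ?_ isClosed_Icc isClosed_Icc
    · exact hXc.congr fun s hs => if_pos hs.2
    · have hcont : Continuous fun s => φ (s - T) * X T :=
        (hφc.comp (continuous_id.sub continuous_const)).mul continuous_const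
      refine hcont.continuousOn.congr fun s hs => ?_
      by_cases h : s ≤ T
      · obtain rfl : s = T := le_antisymm h hs.1
        simp [hφ0]
      · simp only [if_neg h]
  · intro t ht htF i j
    have htT : t ≠ T := fun h => htF (h ▸ Finset.mem_insert_self _ _)
    rcases lt_or_gt_of_ne htT with hlt | hgt
    · have := hF t ⟨ht.1, hlt⟩ (fun h => htF (Finset.mem_insert_of_mem h)) i j
      simp only [if_pos hlt.le]
      refine this.congr_of_eventuallyEq ?_
      filter_upwards [Iio_mem_nhds hlt] with s hs
      rw [if_pos (le_of_lt hs)]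
    · simp only [if_neg (not_le.2 hgt)]
      have h1 : HasDerivAt (fun s : ℝ => NormedSpace.exp ((s - T) • Z) *
          (X T : Matrix (Fin N) (Fin N) ℂ)) (Z * NormedSpace.exp ((t - T) • Z) * X T) t :=
        ((hasDerivAt_exp_smul_const' (𝕂 := ℝ) Z (t - T)).comp_sub_const t T).mul_const _
      have h2 := hasDerivAt_entry h1 i j
      rw [mul_assoc] at h2
      refine h2.congr_of_eventuallyEq ?_
      filter_upwards [Ioi_mem_nhds hgt] with s hs
      rw [if_neg (not_le.2 hs)]
      rfl
  · by_cases h : T + τ ≤ T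
    · have h0 : τ = 0 := le_antisymm (by linarith) hτ
      subst h0
      have : W = 1 := Subtype.ext (by simpa using hW)
      simp [this]
    · simp only [if_neg h]
      congr 1
      refine Subtype.ext ?_
      rw [hW, add_sub_cancel_left]

theorem mem_reachableSet_of_mem_flowMonoid {A B : Matrix (Fin N) (Fin N) ℂ} (hA : A ∈ su N)
    (hB : B ∈ su N) {X : specialUnitaryGroup (Fin N) ℂ}
    (hX : (X : Matrix (Fin N) (Fin N) ℂ) ∈ flowMonoid A B) : X ∈ reachableSet A B := by
  have key : ∀ x ∈ flowMonoid A B, ∃ Y ∈ reachableSet A B, (Y : Matrix (Fin N) (Fin N) ℂ) = x := by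
    intro x hx
    induction hx using Submonoid.closure_induction_left with
    | one => exact ⟨1, one_mem_reachableSet A B, rfl⟩
    | mul_left x hx y hy ih =>
      obtain ⟨t, ht, c, rfl⟩ := hx
      obtain ⟨Y, hY, rfl⟩ := ih
      exact ⟨_, flow_mul_mem_reachableSet hA hB hY ht c (W := ⟨_,
        exp_mem_specialUnitaryGroup (real_smul_mem_su (control_mem_su hA hB c) t)⟩) rfl, rfl⟩
  obtain ⟨Y, hY, hYX⟩ := key _ hX
  rwa [← Subtype.ext hYX]

end Reachability

end QControl
namespace QControl

open Matrix Filter Topology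

/-! ### Tangent directions of the flow monoid -/

section Tangent

open scoped Matrix.Norms.L2Operator

variable {N : ℕ}

/-- `T` consists of velocities (translated to the identity from the right) of a strictly
differentiable family of elements of `S` through `g`. -/
def HasTangent (S : Set (Matrix (Fin N) (Fin N) ℂ)) (g : Matrix (Fin N) (Fin N) ℂ)
    (T : Submodule ℝ (Matrix (Fin N) (Fin N) ℂ)) : Prop :=
  ∃ (E : Type) (_ : NormedAddCommGroup E) (_ : NormedSpace ℝ E) (_ : CompleteSpace E)
    (F : E → Matrix (Fin N) (Fin N) ℂ) (F' : E →L[ℝ] Matrix (Fin N) (Fin N) ℂ),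
    (∀ᶠ p in 𝓝 0, F p ∈ S) ∧ F 0 = g ∧ HasStrictFDerivAt F F' 0 ∧ ∀ v ∈ T, ∃ p, F' p = v * g

theorem HasTangent.mem {S : Set (Matrix (Fin N) (Fin N) ℂ)} {g : Matrix (Fin N) (Fin N) ℂ}
    {T : Submodule ℝ (Matrix (Fin N) (Fin N) ℂ)} (h : HasTangent S g T) : g ∈ S := by
  obtain ⟨E, _, _, _, F, F', hS, rfl, -⟩ := h
  exact hS.self_of_nhds

theorem hasTangent_bot {S : Set (Matrix (Fin N) (Fin N) ℂ)} {g : Matrix (Fin N) (Fin N) ℂ}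
    (hg : g ∈ S) : HasTangent S g ⊥ := by
  refine ⟨ℝ, inferInstance, inferInstance, inferInstance, fun _ => g, 0, Eventually.of_forall
    fun _ => hg, rfl, hasStrictFDerivAt_const _ _, fun v hv => ⟨0, ?_⟩⟩
  simp [(Submodule.mem_bot ℝ).1 hv]

/-- Multiply the family by $h\,e^{(1+t)Z}$. The shift by 1 keeps the flow time positive for $t$ near
0 of either sign, so the new parameter is two-sided. Translated back to the identity, its velocity
is $Z$ conjugated by $gh$, while the old velocities are unchanged. -/
theorem HasTangent.mul_flow {P : Submonoid (Matrix (Fin N) (Fin N) ℂ)}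
    (hP : P ≤ specialUnitaryGroup (Fin N) ℂ) {g : Matrix (Fin N) (Fin N) ℂ}
    {T : Submodule ℝ (Matrix (Fin N) (Fin N) ℂ)} (hT : HasTangent (P : Set _) g T)
    {h Z : Matrix (Fin N) (Fin N) ℂ} (hh : h ∈ P)
    (hZ : ∀ t : ℝ, 0 ≤ t → NormedSpace.exp (t • Z) ∈ P) :
    HasTangent (P : Set _) (g * (h * NormedSpace.exp Z))
      (T ⊔ Submodule.span ℝ {g * h * Z * star (g * h)}) := by
  have hg := hT.mem
  obtain ⟨E, _, _, _, F, F', hS, hF0, hF, hsurj⟩ := hT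
  have hgh : star (g * h) * (g * h) = 1 := Unitary.star_mul_self_of_mem
    (specialUnitaryGroup_le_unitaryGroup (hP (mul_mem hg hh)))
  have hexp : HasStrictDerivAt (fun t : ℝ => NormedSpace.exp ((1 + t) • Z))
      (Z * NormedSpace.exp Z) 0 := by
    have h1 := (hasStrictDerivAt_exp_smul_const' (𝕂 := ℝ) Z (1 + 0)).scomp (0 : ℝ)
      ((hasStrictDerivAt_id (0 : ℝ)).const_add 1)
    simpa using! h1
  have h2 : HasStrictFDerivAt (fun q : E × ℝ => NormedSpace.exp ((1 + q.2) • Z)) _ (0 : E × ℝ) :=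
    HasStrictFDerivAt.comp (0 : E × ℝ) (g := fun t : ℝ => NormedSpace.exp ((1 + t) • Z))
      (f := Prod.snd) hexp.hasStrictFDerivAt hasStrictFDerivAt_snd
  have h1 : HasStrictFDerivAt (fun q : E × ℝ => F q.1) _ (0 : E × ℝ) :=
    HasStrictFDerivAt.comp (0 : E × ℝ) (g := F) (f := Prod.fst) hF hasStrictFDerivAt_fst
  have h3 := h1.mul' (h2.const_mul h)
  refine ⟨E × ℝ, inferInstance, inferInstance, inferInstance, _, _, ?_, ?_, h3, ?_⟩
  · have e1 : ∀ᶠ q : E × ℝ in 𝓝 0, F q.1 ∈ P :=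
      (continuous_fst.tendsto (0 : E × ℝ)).eventually hS
    have e2 : ∀ᶠ q : E × ℝ in 𝓝 0, (-1 : ℝ) < q.2 :=
      (continuous_snd.tendsto (0 : E × ℝ)).eventually (lt_mem_nhds (by norm_num))
    filter_upwards [e1, e2] with q hq1 hq2
    exact mul_mem hq1 (mul_mem hh (hZ _ (by linarith)))
  · simp [hF0]
  · intro v hv
    obtain ⟨v1, hv1, v2, hv2, rfl⟩ := Submodule.mem_sup.1 hv
    obtain ⟨r, rfl⟩ := Submodule.mem_span_singleton.1 hv2
    obtain ⟨p, hp⟩ := hsurj v1 hv1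
    refine ⟨(p, r), ?_⟩
    have h4 : g * h * Z * star (g * h) * (g * (h * NormedSpace.exp Z)) =
        g * (h * (Z * NormedSpace.exp Z)) := by
      calc _ = g * h * Z * (star (g * h) * (g * h)) * NormedSpace.exp Z := by noncomm_ring
        _ = _ := by rw [hgh]; noncomm_ring
    rw [add_mul, smul_mul_assoc, h4]
    simp [hF0, hp]
    noncomm_ring

/-- A tangent space of maximal dimension contains the conjugates of all the control fields. -/
theorem exists_hasTangent_forall_conj_mem {A B : Matrix (Fin N) (Fin N) ℂ} (hA : A ∈ su N)
    (hB : B ∈ su N) : ∃ g T, HasTangent (flowMonoid A B : Set _) g T ∧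
      ∀ h ∈ flowMonoid A B, ∀ c : ℝ, g * h * (A + (c : ℂ) • B) * star (g * h) ∈ T := by
  let s : Set ℕ := {n | ∃ g T, HasTangent (flowMonoid A B : Set (Matrix (Fin N) (Fin N) ℂ)) g T ∧
    Module.finrank ℝ T = n}
  have hne : s.Nonempty := ⟨_, 1, ⊥, hasTangent_bot (one_mem _), rfl⟩
  have hbdd : BddAbove s := by
    refine ⟨Module.finrank ℝ (Matrix (Fin N) (Fin N) ℂ), ?_⟩
    rintro _ ⟨g, T, -, rfl⟩
    exact Submodule.finrank_le T
  obtain ⟨g, T, hT, hmax⟩ := Nat.sSup_mem hne hbdd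
  refine ⟨g, T, hT, fun h hh c => ?_⟩
  -- The enlarged space is again a tangent space, at another point, so maximality forces the added
  -- line to lie in `T` already.
  have hle := le_csSup hbdd ⟨_, _, hT.mul_flow (flowMonoid_le hA hB) hh
    fun t ht => exp_mem_flowMonoid A B ht c, rfl⟩
  rw [← hmax] at hle
  have heq := Submodule.eq_of_le_of_finrank_le le_sup_left hle
  rw [heq]
  exact Submodule.mem_sup_right (Submodule.mem_span_singleton_self _)

/-- The span of the conjugates of the control fields by elements of the flow monoid. -/
noncomputable def conjSpan (A B : Matrix (Fin N) (Fin N) ℂ) :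
    Submodule ℝ (Matrix (Fin N) (Fin N) ℂ) :=
  Submodule.span ℝ {X | ∃ h ∈ flowMonoid A B, ∃ c : ℝ, X = h * (A + (c : ℂ) • B) * star h}

theorem conj_mem_of_mem_conjSpan {A B : Matrix (Fin N) (Fin N) ℂ} {g : Matrix (Fin N) (Fin N) ℂ}
    {T : Submodule ℝ (Matrix (Fin N) (Fin N) ℂ)}
    (h : ∀ h ∈ flowMonoid A B, ∀ c : ℝ, g * h * (A + (c : ℂ) • B) * star (g * h) ∈ T)
    {v : Matrix (Fin N) (Fin N) ℂ} (hv : v ∈ conjSpan A B) : g * v * star g ∈ T := by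
  induction hv using Submodule.span_induction with
  | mem x hx =>
    obtain ⟨k, hk, c, rfl⟩ := hx
    convert h k hk c using 1
    rw [star_mul]
    noncomm_ring
  | zero => simp
  | add x y _ _ hx hy =>
    rw [mul_add, add_mul]
    exact T.add_mem hx hy
  | smul r x _ hx =>
    rw [mul_smul_comm, smul_mul_assoc]
    exact T.smul_mem r hx

theorem control_mem_conjSpan (A B : Matrix (Fin N) (Fin N) ℂ) (c : ℝ) :
    A + (c : ℂ) • B ∈ conjSpan A B :=
  Submodule.subset_span ⟨1, one_mem _, c, by simp⟩

theorem star_exp_of_mem_su {Z : Matrix (Fin N) (Fin N) ℂ} (hZ : Z ∈ su N) (t : ℝ) :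
    star (NormedSpace.exp (t • Z)) = NormedSpace.exp (t • (-Z)) := by
  rw [star_eq_conjTranspose, ← exp_conjTranspose, conjTranspose_smul, hZ.1]
  simp

attribute [local instance] LieRing.ofAssociativeRing

/-- For $t\ge0$, conjugation by $e^{tZ}$ preserves `conjSpan`, because $e^{tZ}$ lies in the monoid.
The bracket is its derivative at 0, taken from the right since only forward flows are available; a
finite-dimensional subspace is closed under this limit. -/
theorem lie_control_mem_conjSpan {A B : Matrix (Fin N) (Fin N) ℂ} (hA : A ∈ su N) (hB : B ∈ su N)
    (c : ℝ) {v : Matrix (Fin N) (Fin N) ℂ} (hv : v ∈ conjSpan A B) :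
    ⁅A + (c : ℂ) • B, v⁆ ∈ conjSpan A B := by
  set Z := A + (c : ℂ) • B with hZdef
  have hZ : Z ∈ su N := control_mem_su hA hB c
  have hd : HasDerivAt (fun t : ℝ => NormedSpace.exp (t • Z) * v * NormedSpace.exp (t • (-Z)))
      ⁅Z, v⁆ 0 := by
    have h1 := ((hasDerivAt_exp_smul_const' (𝕂 := ℝ) Z 0).mul_const v).mul
      (hasDerivAt_exp_smul_const' (𝕂 := ℝ) (-Z) 0)
    convert! h1 using 1
    simp [Ring.lie_def, sub_eq_add_neg]
  have ht := hd.tendsto_slope.mono_left (nhdsWithin_mono (0 : ℝ)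
    (show Set.Ioi (0 : ℝ) ⊆ {0}ᶜ from fun t ht => ne_of_gt ht))
  refine (Submodule.closed_of_finiteDimensional (conjSpan A B)).mem_of_tendsto ht ?_
  filter_upwards [self_mem_nhdsWithin] with t ht
  rw [slope_def_module]
  refine Submodule.smul_mem _ _ (Submodule.sub_mem _ ?_ (by simpa using hv))
  rw [← star_exp_of_mem_su hZ]
  refine conj_mem_of_mem_conjSpan (fun h hh c' => ?_) hv
  exact Submodule.subset_span ⟨_, mul_mem (exp_mem_flowMonoid A B (le_of_lt ht) c) hh, c', rfl⟩

/-- The elements of `conjSpan A B` that normalize it. -/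
noncomputable def conjLieSubalgebra (A B : Matrix (Fin N) (Fin N) ℂ) :
    LieSubalgebra ℝ (Matrix (Fin N) (Fin N) ℂ) where
  carrier := {X | X ∈ conjSpan A B ∧ ∀ v ∈ conjSpan A B, ⁅X, v⁆ ∈ conjSpan A B}
  zero_mem' := ⟨Submodule.zero_mem _, fun v _ => by simp⟩
  add_mem' := fun {X Y} hX hY => ⟨Submodule.add_mem _ hX.1 hY.1, fun v hv => by
    rw [add_lie]
    exact Submodule.add_mem _ (hX.2 v hv) (hY.2 v hv)⟩
  smul_mem' := fun r X hX => ⟨Submodule.smul_mem _ _ hX.1, fun v hv => by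
    rw [smul_lie]
    exact Submodule.smul_mem _ _ (hX.2 v hv)⟩
  lie_mem' := fun {X Y} hX hY => ⟨hX.2 Y hY.1, fun v hv => by
    rw [lie_lie]
    exact Submodule.sub_mem _ (hX.2 _ (hY.2 v hv)) (hY.2 _ (hX.2 v hv))⟩

theorem mem_conjLieSubalgebra {A B X : Matrix (Fin N) (Fin N) ℂ} :
    X ∈ conjLieSubalgebra A B ↔
      X ∈ conjSpan A B ∧ ∀ v ∈ conjSpan A B, ⁅X, v⁆ ∈ conjSpan A B := Iff.rfl

theorem control_mem_conjLieSubalgebra {A B : Matrix (Fin N) (Fin N) ℂ} (hA : A ∈ su N)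
    (hB : B ∈ su N) (c : ℝ) : A + (c : ℂ) • B ∈ conjLieSubalgebra A B :=
  ⟨control_mem_conjSpan A B c, fun _ hv => lie_control_mem_conjSpan hA hB c hv⟩

theorem drift_mem_conjLieSubalgebra {A B : Matrix (Fin N) (Fin N) ℂ} (hA : A ∈ su N)
    (hB : B ∈ su N) : A ∈ conjLieSubalgebra A B := by
  simpa using control_mem_conjLieSubalgebra hA hB 0

theorem control_direction_mem_conjLieSubalgebra {A B : Matrix (Fin N) (Fin N) ℂ} (hA : A ∈ su N)
    (hB : B ∈ su N) : B ∈ conjLieSubalgebra A B := by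
  simpa using sub_mem (control_mem_conjLieSubalgebra hA hB 1) (drift_mem_conjLieSubalgebra hA hB)

/-! ### The flow monoid has interior points -/

theorem conj_mem_su {g v : Matrix (Fin N) (Fin N) ℂ}
    (hg : g ∈ specialUnitaryGroup (Fin N) ℂ) (hv : v ∈ su N) : star g * v * g ∈ su N := by
  have hgg : g * star g = 1 :=
    Unitary.mul_star_self_of_mem (specialUnitaryGroup_le_unitaryGroup hg)
  refine ⟨?_, ?_⟩
  · rw [← star_eq_conjTranspose, star_mul, star_mul, star_star, star_eq_conjTranspose v, hv.1]
    noncomm_ring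
  · rw [trace_mul_comm, ← mul_assoc, hgg, one_mul, hv.2]

/-- The maximal `T` contains $g\,\mathfrak{su}(N)\,g^*$, and conjugation by $g$ maps
$\mathfrak{su}(N)$ onto itself. -/
theorem exists_hasTangent_su {A B : Matrix (Fin N) (Fin N) ℂ} (hA : A ∈ su N) (hB : B ∈ su N)
    (hL : su N ⊆ conjLieSubalgebra A B) :
    ∃ (g : Matrix (Fin N) (Fin N) ℂ) (T : Submodule ℝ (Matrix (Fin N) (Fin N) ℂ)),
      HasTangent (flowMonoid A B : Set _) g T ∧ su N ⊆ (T : Set _) := by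
  obtain ⟨g, T, hT, hconj⟩ := exists_hasTangent_forall_conj_mem hA hB
  refine ⟨g, T, hT, fun v hv => ?_⟩
  have hg := flowMonoid_le hA hB hT.mem
  have hgg : g * star g = 1 :=
    Unitary.mul_star_self_of_mem (specialUnitaryGroup_le_unitaryGroup hg)
  have h1 := conj_mem_of_mem_conjSpan hconj (mem_conjLieSubalgebra.1 (hL (conj_mem_su hg hv))).1
  have h2 : g * (star g * v * g) * star g = v := by
    calc _ = (g * star g) * v * (g * star g) := by noncomm_ring
      _ = v := by rw [hgg]; noncomm_ring
  rwa [h2] at h1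

/-- Directions transverse to $SU(N)$: the trace of the skew-Hermitian part gives $\theta$, and
$K=(Y+Y^*)/4$ makes $K+K^*$ the Hermitian part. -/
theorem exists_decomposition [NeZero N] (Y : Matrix (Fin N) (Fin N) ℂ) :
    ∃ v ∈ su N, ∃ (θ : ℝ) (K : Matrix (Fin N) (Fin N) ℂ),
      Y = v + (θ * Complex.I : ℂ) • (1 : Matrix (Fin N) (Fin N) ℂ) + (K + star K) := by
  have hN : (N : ℂ) ≠ 0 := Nat.cast_ne_zero.2 (NeZero.ne N)
  let θ : ℝ := (Y.trace).im / N
  refine ⟨(1 / 2 : ℂ) • (Y - star Y) - (θ * Complex.I : ℂ) • 1, ⟨?_, ?_⟩, θ,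
    (1 / 4 : ℂ) • (Y + star Y), ?_⟩
  · simp [conjTranspose_sub, conjTranspose_smul, star_eq_conjTranspose]
    module
  · have h1 : (Y.trace).im * Complex.I = (1 / 2 : ℂ) * (Y.trace - star Y.trace) := by
      apply Complex.ext <;> simp
      ring
    simp only [star_eq_conjTranspose, trace_sub, trace_smul, trace_conjTranspose, trace_one,
      Fintype.card_fin, smul_eq_mul, θ]
    rw [← h1]
    push_cast
    field_simp
    simp
  · simp [star_eq_conjTranspose]
    module

theorem eq_zero_of_isHermitian_of_sq {H : Matrix (Fin N) (Fin N) ℂ}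
    (hsq : (1 + H) * (1 + H) = 1) (hdet : (2 + H).det ≠ 0) : H = 0 := by
  have h1 : H * (2 + H) = 0 := by
    have : H * (2 + H) = (1 + H) * (1 + H) - 1 := by noncomm_ring
    rw [this, hsq, sub_self]
  have hu : IsUnit (2 + H) := (Matrix.isUnit_iff_isUnit_det _).2 hdet.isUnit
  exact hu.mul_left_eq_zero.1 h1

/-- Unitarity of $x$ gives $(1+H)^2=1$, that is $H(2+H)=0$, so $H=0$. Determinants then give
$e^{iN\theta}=1$, and the bound on $N\theta$ leaves only $\theta=0$. -/
theorem eq_of_polar [NeZero N] {U x H : Matrix (Fin N) (Fin N) ℂ} {θ : ℝ}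
    (hU : U ∈ specialUnitaryGroup (Fin N) ℂ) (hx : x ∈ specialUnitaryGroup (Fin N) ℂ)
    (hH : star H = H) (hdet : (2 + H).det ≠ 0) (hθ : |N * θ| < 2 * Real.pi)
    (hxe : x = Complex.exp (θ * Complex.I) • ((1 + H) * U)) : x = U := by
  have hUU : U * star U = 1 :=
    Unitary.mul_star_self_of_mem (specialUnitaryGroup_le_unitaryGroup hU)
  have hxx : x * star x = 1 :=
    Unitary.mul_star_self_of_mem (specialUnitaryGroup_le_unitaryGroup hx)
  have hc : Complex.exp (θ * Complex.I) * star (Complex.exp (θ * Complex.I)) = 1 := by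
    have := Complex.mul_conj' (Complex.exp (θ * Complex.I))
    rw [Complex.norm_exp_ofReal_mul_I] at this
    simpa using this
  have hsq : (1 + H) * (1 + H) = 1 := by
    refine Eq.trans ?_ hxx
    rw [hxe, star_smul, smul_mul_smul_comm, hc, one_smul, star_mul, star_add, hH, star_one]
    calc (1 + H) * (1 + H) = (1 + H) * (U * star U) * (1 + H) := by rw [hUU, mul_one]
      _ = (1 + H) * U * (star U * (1 + H)) := by simp only [mul_assoc]
  have hH0 := eq_zero_of_isHermitian_of_sq hsq hdet
  subst hH0
  rw [add_zero, one_mul] at hxe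
  have hd := congrArg Matrix.det hxe
  rw [det_smul, (mem_specialUnitaryGroup_iff.1 hU).2, (mem_specialUnitaryGroup_iff.1 hx).2,
    mul_one, Fintype.card_fin, ← Complex.exp_nat_mul] at hd
  obtain ⟨n, hn⟩ := Complex.exp_eq_one_iff.1 hd.symm
  have hn' : (N : ℝ) * θ = n * (2 * Real.pi) := by
    have := congrArg Complex.im hn
    simpa using this
  have hn0 : n = 0 := by
    rw [hn', abs_mul, abs_of_pos Real.two_pi_pos] at hθ
    have h1 : |(n : ℝ)| < 1 := by
      by_contra! h
      nlinarith [Real.two_pi_pos]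
    exact Int.abs_lt_one_iff.1 (by exact_mod_cast h1)
  have hθ0 : θ = 0 := by
    rw [hn0, Int.cast_zero, zero_mul] at hn'
    exact (mul_eq_zero.1 hn').resolve_left (Nat.cast_ne_zero.2 (NeZero.ne N))
  rw [hxe, hθ0]
  simp

/-- The map $(p,K,\theta)\mapsto e^{i\theta}(1+K+K^*)F(p)$ has surjective derivative at 0, so its
values near 0 fill a neighbourhood of $g$ among all matrices. By `eq_of_polar`, a value lying in
$SU(N)$ equals $F(p)$, which is in `S`. -/
theorem HasTangent.eventually_mem [NeZero N] {S : Set (Matrix (Fin N) (Fin N) ℂ)}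
    (hS : S ⊆ specialUnitaryGroup (Fin N) ℂ) {g : Matrix (Fin N) (Fin N) ℂ}
    {T : Submodule ℝ (Matrix (Fin N) (Fin N) ℂ)} (h : HasTangent S g T) (hT : su N ⊆ (T : Set _)) :
    ∀ᶠ x in 𝓝 g, x ∈ specialUnitaryGroup (Fin N) ℂ → x ∈ S := by
  have hgg : star g * g = 1 :=
    Unitary.star_mul_self_of_mem (specialUnitaryGroup_le_unitaryGroup (hS h.mem))
  obtain ⟨E, _, _, _, F, F', hF, hF0, hd, hsurj⟩ := h
  let Q := E × Matrix (Fin N) (Fin N) ℂ × ℝ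
  have d1 : HasStrictFDerivAt (fun q : Q => F q.1) _ (0 : Q) :=
    HasStrictFDerivAt.comp (0 : Q) (g := F) (f := Prod.fst) hd hasStrictFDerivAt_fst
  let ΛK : Q →L[ℝ] Matrix (Fin N) (Fin N) ℂ :=
    (ContinuousLinearMap.fst ℝ _ _).comp (ContinuousLinearMap.snd ℝ _ _)
  let Λθ : Q →L[ℝ] ℝ := (ContinuousLinearMap.snd ℝ _ _).comp (ContinuousLinearMap.snd ℝ _ _)
  let σ : Matrix (Fin N) (Fin N) ℂ →L[ℝ] Matrix (Fin N) (Fin N) ℂ :=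
    (starL' ℝ : Matrix (Fin N) (Fin N) ℂ ≃L[ℝ] Matrix (Fin N) (Fin N) ℂ)
  have d2 : HasStrictFDerivAt (fun q : Q => 1 + (q.2.1 + star q.2.1)) (ΛK + σ.comp ΛK) (0 : Q) :=
    (ΛK + σ.comp ΛK).hasStrictFDerivAt.const_add 1
  have d3' : HasStrictDerivAt (fun θ : ℝ => Complex.exp (θ * Complex.I)) Complex.I (0 : ℝ) := by
    have h1 := (Complex.ofRealCLM.hasStrictDerivAt (x := (0 : ℝ))).mul_const Complex.I |>.cexp
    simpa using! h1
  have d3 : HasStrictFDerivAt (fun q : Q => Complex.exp (q.2.2 * Complex.I)) _ (0 : Q) :=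
    HasStrictFDerivAt.comp (0 : Q) (g := fun θ : ℝ => Complex.exp (θ * Complex.I))
      (f := fun q : Q => q.2.2) d3'.hasStrictFDerivAt Λθ.hasStrictFDerivAt
  have d4 := d3.smul (d2.mul' d1)
  have hmap := d4.map_nhds_eq_of_surj (by
    rw [LinearMap.range_eq_top]
    intro M
    obtain ⟨v, hv, θ, K, hY⟩ := exists_decomposition (M * star g)
    obtain ⟨p, hp⟩ := hsurj v (hT hv)
    refine ⟨(p, K, θ), ?_⟩
    have hM : M = (v + (θ * Complex.I : ℂ) • (1 : Matrix (Fin N) (Fin N) ℂ) + (K + star K)) * g := by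
      rw [← hY, mul_assoc, hgg, mul_one]
    rw [hM, add_mul, add_mul, ← hp]
    simp [ΛK, Λθ, σ, hF0]
    change F' p + (K * g + star K * g) + (θ * Complex.I : ℂ) • g = _
    rw [add_mul]
    abel)
  have hgood : ∀ᶠ q : Q in 𝓝 0, F q.1 ∈ S ∧ (2 + (q.2.1 + star q.2.1)).det ≠ 0 ∧
      |(N : ℝ) * q.2.2| < 2 * Real.pi := by
    refine ((continuous_fst.tendsto (0 : Q)).eventually hF).and (Eventually.and ?_ ?_)
    · have hc : Continuous fun q : Q => (2 + (q.2.1 + star q.2.1)).det := by fun_prop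
      refine hc.continuousAt.eventually_ne ?_
      have h2 : (2 : Matrix (Fin N) (Fin N) ℂ) = (2 : ℂ) • 1 := by
        ext i j
        simp [Matrix.one_apply, Matrix.ofNat_apply]
      simp [h2]
    · have hc : Continuous fun q : Q => |(N : ℝ) * q.2.2| := by fun_prop
      refine hc.continuousAt.eventually_lt continuousAt_const ?_
      simpa using Real.pi_pos
  have himg := image_mem_map (m := fun q : Q => Complex.exp (q.2.2 * Complex.I) •
    ((1 + (q.2.1 + star q.2.1)) * F q.1)) hgood
  have hmap' : map (fun q : Q => Complex.exp (q.2.2 * Complex.I) •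
    ((1 + (q.2.1 + star q.2.1)) * F q.1)) (𝓝 0) = 𝓝 g := by
    refine Eq.trans hmap ?_
    simp [hF0]
  rw [hmap'] at himg
  filter_upwards [himg] with x hx hxSU
  obtain ⟨q, ⟨hq1, hq2, hq3⟩, rfl⟩ := hx
  have := eq_of_polar (hS hq1) hxSU (H := q.2.1 + star q.2.1) (by simp [add_comm]) hq2 hq3 rfl
  simp only at this ⊢
  rw [this]
  exact hq1

end Tangent

/-! ### Controllability -/

section Controllability

variable {N : ℕ}

/-- A submonoid of a connected compact group that is a neighbourhood of one of its points is the
whole group. -/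
theorem submonoid_eq_top_of_mem_nhds {G : Type*} [Group G] [TopologicalSpace G]
    [IsTopologicalGroup G] [CompactSpace G] [ConnectedSpace G] {S : Submonoid G} {g : G}
    (hg : (S : Set G) ∈ 𝓝 g) : S = ⊤ := by
  -- By compactness, inverses are limits of positive powers, so the submonoid and the subgroup it
  -- generates have the same closure.
  have hcl : closure (S : Set G) = closure (Subgroup.closure (S : Set G) : Set G) := by
    have := closure_submonoidClosure_eq_closure_subgroupClosure (S : Set G)
    rwa [Submonoid.closure_eq] at this
  have hopen : IsOpen ((Subgroup.closure (S : Set G)) : Set G) :=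
    Subgroup.isOpen_of_mem_nhds _ (g := g) (mem_of_superset hg Subgroup.subset_closure)
  have htop : (Subgroup.closure (S : Set G) : Set G) = Set.univ :=
    IsClopen.eq_univ ⟨Subgroup.isClosed_of_isOpen _ hopen, hopen⟩ ⟨1, one_mem _⟩
  have hdense : Dense (S : Set G) := by
    rw [dense_iff_closure_eq, hcl, htop, closure_univ]
  rw [eq_top_iff]
  intro x _
  -- For $y$ near $xg^{-1}$ the element $y^{-1}x$ is near $g$, hence in `S`. Density supplies such a
  -- $y$ in `S`, and $x=y\,(y^{-1}x)$.
  have hnhds : (fun y => y⁻¹ * x) ⁻¹' (S : Set G) ∈ 𝓝 (x * g⁻¹) := by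
    refine ContinuousAt.preimage_mem_nhds (by fun_prop) ?_
    simpa using hg
  obtain ⟨y, hy1, hy2⟩ := hdense.inter_nhds_nonempty hnhds
  have := S.mul_mem hy1 hy2
  simpa using this

theorem drift_mem_su (E : realCartan N) : drift E ∈ su N := by
  refine ⟨?_, ?_⟩
  · rw [drift, diagonal_conjTranspose, diagonal_neg]
    congr 1
    ext k
    simp
  · rw [drift, trace_diagonal, ← Finset.mul_sum]
    have := mem_realCartan.1 E.2
    rw [← Complex.ofReal_sum, this]
    simp

theorem controllable_of_su_subset [NeZero N] {A B : Matrix (Fin N) (Fin N) ℂ} (hA : A ∈ su N)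
    (hB : B ∈ su N) (hL : su N ⊆ conjLieSubalgebra A B) : Controllable A B := by
  obtain ⟨g, T, hT, hsu⟩ := exists_hasTangent_su hA hB hL
  have hev := hT.eventually_mem (flowMonoid_le hA hB) hsu
  let g' : specialUnitaryGroup (Fin N) ℂ := ⟨g, flowMonoid_le hA hB hT.mem⟩
  have hmem : (((flowMonoid A B).comap (specialUnitaryGroup (Fin N) ℂ).subtype :
      Submonoid (specialUnitaryGroup (Fin N) ℂ)) : Set (specialUnitaryGroup (Fin N) ℂ)) ∈
      𝓝 g' := by
    have h1 := (continuous_subtype_val.tendsto g').eventually hev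
    filter_upwards [h1] with x hx
    exact hx x.2
  have htop := submonoid_eq_top_of_mem_nhds hmem
  refine Set.eq_univ_of_forall fun X => mem_reachableSet_of_mem_flowMonoid hA hB ?_
  have : X ∈ (flowMonoid A B).comap (specialUnitaryGroup (Fin N) ℂ).subtype := by
    rw [htop]
    trivial
  exact this

end Controllability

end QControl

theorem mainTheorem5 (N : ℕ) (E : QControl.realCartan N) (hE : Monotone (E : Fin N → ℝ))
    (B : Matrix (Fin N) (Fin N) ℂ) (hB : B ∈ QControl.su N)
    (hΦ : QControl.fundamentalRoots N ⊆ QControl.touchedRegularRoots E B) :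
    QControl.Controllable (QControl.drift E) B := by
  -- The case $N=0$ is separate because extracting $\theta$ divides by $N$; there the group is
  -- trivial.
  rcases N.eq_zero_or_pos with rfl | hN
  · refine Set.eq_univ_of_forall fun X => ?_
    rw [show X = 1 from Subtype.ext (Subsingleton.elim _ _)]
    exact QControl.one_mem_reachableSet _ _
  · have : NeZero N := ⟨hN.ne'⟩
    have hA := QControl.drift_mem_su E
    exact QControl.controllable_of_su_subset hA hB
      (QControl.su_subset_of_fundamentalRoots_subset hB hΦ
        (QControl.drift_mem_conjLieSubalgebra hA hB)
        (QControl.control_direction_mem_conjLieSubalgebra hA hB))
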